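/- Let $r\ge 2$, $\mathcal A=\{1,\dots,r\}$, $\Omega=\mathcal A^{\mathbb N}$ with the product topology and the metric $d(x,y)=2^{-\min\{n\ge 1:\,x_n\ne y_n\}}$ for $x\neq y$, $d(x,x)=0$. For $j\in\mathcal A$ and $x\in\Omega$ write $jx=(j,x_1,x_2,\dots)$. Let $\beta>0$, $\mu<0$, and let $A_N:\Omega\to\mathbb R$, $N\in\mathbb N_0=\{0,1,2,\dots\}$, be functions such that (H1) there is $M>0$ with $|A_N(x)-A_N(y)|\le M\,d(x,y)$ for all $x,y\in\Omega$ and all $N\in\mathbb N_0$; (H2) $\limsup_{N\to\infty} A_N(x)/N>\mu$ for every $x\in\Omega$; (admissibility) $\sum_{N\ge 0}e^{\beta\mu N}\sum_{a\in\mathcal A}e^{-\beta A_N(ax)}<\infty$ for every $x\in\Omega$. (Admissibility holds automatically if $\liminf_{N\to\infty}A_N(x)/N>\mu$ for every $x$.) Then the grand-canonical Ruelle operator $$\mathcal L f(x)=\mathcal L_{\beta,\mu}f(x)=\sum_{N\ge 0}e^{\beta\mu N}\sum_{a\in\mathcal A}e^{-\beta A_N(ax)}f(ax)$$ is a bounded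 operator on $C(\Omega)$ with the supremum norm. Let $\mathcal L^*:C(\Omega)^*\to C(\Omega)^*$, $\mathcal L^*\varphi=\varphi\circ\mathcal L$, be its dual, Borel probability measures $\theta$ on $\Omega$ being identified with the functionals $g\mapsto\theta(g)=\int g\,d\theta$. The spectral radius $\lambda$ of $\mathcal L$ on $C(\Omega)$ (the same for real and for complex scalars) is positive and finite, and there are a continuous function $h:\Omega\to\mathbb R$ with $h>0$ and a Borel probability measure $\nu$ on $\Omega$ such that $$\mathcal L h=\lambda h,\qquad \mathcal L^*\nu=\lambda\nu,\qquad \nu(h)=1.$$ Both are unique: $\nu$ is the only Borel probability measure with $\mathcal L^*\nu=\lambda\nu$, and $h$ is the only positive continuous function with $\mathcal L h=\lambda h$ and $\nu(h)=1$. Moreover, for every $g\in C(\Omega)$ the functions $\lambda^{-n}\mathcal L^n g$ converge uniformly to $\nu(g)h$ as $n\to\infty$, and for every Borel probability measure $\theta$ on $\Omega$ the functionals $\lambda^{-n}(\mathcal L^*)^n\theta$ converge weakly (weak-$*$ in $C(\Omega)^*$) to $\theta(h)\nu$. -/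

import Mathlib

open Filter Topology MeasureTheory

namespace GrandCanonical

/-- The symbolic space `Ω = {1, …, r}^ℕ` with its product topology and product (= Borel)
σ-algebra. The coordinate `x n` (`n = 0, 1, …`) is the `(n+1)`-st symbol of the sequence. -/
abbrev SymbolicSpace (r : ℕ) : Type := ℕ → Fin r

/-- The sequence `jx = (j, x₁, x₂, …)`. -/
def prepend {r : ℕ} (j : Fin r) (x : SymbolicSpace r) : SymbolicSpace r
  | 0 => j
  | n + 1 => x n

/-- The metric `d(x, y) = 2 ^ (-min {n ≥ 1 : xₙ ≠ yₙ})` for `x ≠ y`, and `d(x, x) = 0`, symbols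
being numbered from `1`. (`PiNat.firstDiff` numbers them from `0`.) -/
noncomputable def shiftDist {r : ℕ} (x y : SymbolicSpace r) : ℝ :=
  open Classical in if x = y then 0 else (1 / 2 : ℝ) ^ (PiNat.firstDiff x y + 1)

/-- The functions `A_N` are Lipschitz with a common constant `M > 0`. -/
def UniformlyLipschitz {r : ℕ} (A : ℕ → SymbolicSpace r → ℝ) : Prop :=
  ∃ M : ℝ, 0 < M ∧ ∀ N x y, |A N x - A N y| ≤ M * shiftDist x y

/-- `limsup_{N → ∞} A_N(x) / N > K` for every `x`, the `limsup` being taken in `[-∞, ∞]`. -/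
def Superlinear {r : ℕ} (K : ℝ) (A : ℕ → SymbolicSpace r → ℝ) : Prop :=
  ∀ x, (K : EReal) < limsup (fun N : ℕ => ((A N x / N : ℝ) : EReal)) atTop

/-- Admissibility: `∑_N e^{βμN} ∑_a e^{-β A_N(ax)} < ∞` for every `x`. -/
def Admissible {r : ℕ} (β μ : ℝ) (A : ℕ → SymbolicSpace r → ℝ) : Prop :=
  ∀ x, Summable fun N : ℕ =>
    Real.exp (β * μ * N) * ∑ a : Fin r, Real.exp (-β * A N (prepend a x))

/-- If `liminf_{N → ∞} A_N(x) / N > μ` for every `x`, then the family is admissible. -/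
theorem admissible_of_lt_liminf {r : ℕ} {β μ : ℝ} {A : ℕ → SymbolicSpace r → ℝ} (hβ : 0 < β)
    (h : ∀ x, (μ : EReal) < liminf (fun N : ℕ => ((A N x / N : ℝ) : EReal)) atTop) :
    Admissible β μ A := by
  intro x
  simp_rw [Finset.mul_sum]
  refine summable_sum fun a _ => ?_
  obtain ⟨c, hc, hcl⟩ := EReal.lt_iff_exists_real_btwn.1 (h (prepend a x))
  have hμc : μ < c := by exact_mod_cast hc
  have hr : Real.exp (-β * (c - μ)) < 1 := Real.exp_lt_one_iff.2 (by nlinarith)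
  refine Summable.of_norm_bounded_eventually_nat
    (summable_geometric_of_lt_one (Real.exp_pos _).le hr) ?_
  filter_upwards [eventually_lt_of_lt_liminf hcl, eventually_gt_atTop 0] with N hN hN0
  have hN0' : (0 : ℝ) < N := by exact_mod_cast hN0
  have hN' : c * N < A N (prepend a x) := (lt_div_iff₀ hN0').1 (by exact_mod_cast hN)
  rw [← Real.exp_add, Real.norm_eq_abs, abs_of_pos (Real.exp_pos _), ← Real.exp_nat_mul]
  refine Real.exp_le_exp.2 ?_
  nlinarith

/-- `L f (x) = ∑_N e^{βμN} ∑_a e^{-β A_N(ax)} f(ax)`. -/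
noncomputable def ruelleSum {𝕜 : Type*} [RCLike 𝕜] {r : ℕ} (β μ : ℝ)
    (A : ℕ → SymbolicSpace r → ℝ) (f : SymbolicSpace r → 𝕜) (x : SymbolicSpace r) : 𝕜 :=
  ∑' N : ℕ, (Real.exp (β * μ * N) : 𝕜) *
    ∑ a : Fin r, (Real.exp (-β * A N (prepend a x)) : 𝕜) * f (prepend a x)

theorem shiftDist_le_pow {r : ℕ} {x y : SymbolicSpace r} {n : ℕ} (h : y ∈ PiNat.cylinder x n) :
    shiftDist y x ≤ (1 / 2 : ℝ) ^ n := by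
  unfold shiftDist
  split_ifs with hxy
  · positivity
  · have h1 : n ≤ PiNat.firstDiff y x := (PiNat.mem_cylinder_iff_le_firstDiff hxy n).1 h
    exact pow_le_pow_of_le_one (by norm_num) (by norm_num) (by omega)

theorem UniformlyLipschitz.continuous {r : ℕ} {A : ℕ → SymbolicSpace r → ℝ}
    (h : UniformlyLipschitz A) (N : ℕ) : Continuous (A N) := by
  obtain ⟨M, hM, hA⟩ := h
  rw [continuous_iff_continuousAt]
  intro x
  rw [ContinuousAt, Metric.tendsto_nhds]
  intro ε hε
  obtain ⟨n, hn⟩ := exists_pow_lt_of_lt_one (div_pos hε hM) (by norm_num : (1 / 2 : ℝ) < 1)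
  filter_upwards [(PiNat.isOpen_cylinder (fun _ : ℕ => Fin r) x n).mem_nhds
    (PiNat.self_mem_cylinder x n)] with y hy
  rw [Real.dist_eq]
  calc |A N y - A N x| ≤ M * shiftDist y x := hA N y x
    _ ≤ M * (1 / 2 : ℝ) ^ n := by gcongr; exact shiftDist_le_pow hy
    _ < M * (ε / M) := by gcongr
    _ = ε := by field_simp

theorem continuous_prepend {r : ℕ} (a : Fin r) : Continuous (prepend a) := by
  refine continuous_pi fun n => ?_
  cases n with
  | zero => exact continuous_const
  | succ n => exact continuous_apply n

/-- The weights are dominated, uniformly in `x`, by a summable sequence. -/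
theorem exists_weight_bound {r : ℕ} {β μ : ℝ} {A : ℕ → SymbolicSpace r → ℝ}
    (hlip : UniformlyLipschitz A) (hadm : Admissible β μ A) :
    ∃ u : ℕ → ℝ, Summable u ∧ ∀ (N : ℕ) (x : SymbolicSpace r),
      Real.exp (β * μ * N) * ∑ a : Fin r, Real.exp (-β * A N (prepend a x)) ≤ u N := by
  rcases isEmpty_or_nonempty (SymbolicSpace r) with he | ⟨⟨x₀⟩⟩
  · exact ⟨0, summable_zero, fun N x => he.elim x⟩
  obtain ⟨M, hM, hA⟩ := hlip
  refine ⟨_, (hadm x₀).mul_left (Real.exp (|β| * M)), fun N x => ?_⟩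
  rw [mul_left_comm]
  refine mul_le_mul_of_nonneg_left ?_ (Real.exp_pos _).le
  rw [Finset.mul_sum]
  refine Finset.sum_le_sum fun a _ => ?_
  rw [← Real.exp_add]
  gcongr
  have h0 : shiftDist (prepend a x₀) (prepend a x) ≤ 1 := by
    simpa using shiftDist_le_pow (n := 0) (x := prepend a x) (y := prepend a x₀) (by simp)
  have h1 : |A N (prepend a x₀) - A N (prepend a x)| ≤ M :=
    (hA N _ _).trans (by nlinarith)
  have h2 : β * (A N (prepend a x₀) - A N (prepend a x)) ≤ |β| * M := by
    calc _ ≤ |β * (A N (prepend a x₀) - A N (prepend a x))| := le_abs_self _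
      _ = |β| * |A N (prepend a x₀) - A N (prepend a x)| := abs_mul _ _
      _ ≤ _ := by gcongr
  linarith

theorem norm_term_le {𝕜 : Type*} [RCLike 𝕜] {r : ℕ} (β μ : ℝ) (A : ℕ → SymbolicSpace r → ℝ)
    (f : C(SymbolicSpace r, 𝕜)) (N : ℕ) (x : SymbolicSpace r) :
    ‖(Real.exp (β * μ * N) : 𝕜) *
      ∑ a : Fin r, (Real.exp (-β * A N (prepend a x)) : 𝕜) * f (prepend a x)‖ ≤
    (Real.exp (β * μ * N) * ∑ a : Fin r, Real.exp (-β * A N (prepend a x))) * ‖f‖ := by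
  rw [norm_mul, RCLike.norm_ofReal, abs_of_pos (Real.exp_pos _), mul_assoc (Real.exp (β * μ * N)),
    Finset.sum_mul]
  refine mul_le_mul_of_nonneg_left ?_ (Real.exp_pos _).le
  refine (norm_sum_le _ _).trans (Finset.sum_le_sum fun a _ => ?_)
  rw [norm_mul, RCLike.norm_ofReal, abs_of_pos (Real.exp_pos _)]
  gcongr
  exact f.norm_coe_le_norm _

theorem summable_term {𝕜 : Type*} [RCLike 𝕜] {r : ℕ} {β μ : ℝ} {A : ℕ → SymbolicSpace r → ℝ}
    (hadm : Admissible β μ A) (f : C(SymbolicSpace r, 𝕜)) (x : SymbolicSpace r) :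
    Summable fun N : ℕ => (Real.exp (β * μ * N) : 𝕜) *
      ∑ a : Fin r, (Real.exp (-β * A N (prepend a x)) : 𝕜) * f (prepend a x) :=
  Summable.of_norm_bounded ((hadm x).mul_right ‖f‖) fun N => norm_term_le β μ A f N x

theorem continuous_ruelleSum {𝕜 : Type*} [RCLike 𝕜] {r : ℕ} {β μ : ℝ}
    {A : ℕ → SymbolicSpace r → ℝ} (hlip : UniformlyLipschitz A) (hadm : Admissible β μ A)
    (f : C(SymbolicSpace r, 𝕜)) : Continuous (ruelleSum β μ A f) := by
  obtain ⟨u, hu, hb⟩ := exists_weight_bound hlip hadm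
  refine continuous_tsum (fun N => ?_) (hu.mul_right ‖f‖)
    fun N x => (norm_term_le β μ A f N x).trans (by gcongr; exact hb N x)
  refine continuous_const.mul (continuous_finsetSum _ fun a _ => ?_)
  refine (RCLike.continuous_ofReal.comp (Real.continuous_exp.comp
    (continuous_const.mul ((hlip.continuous N).comp (continuous_prepend a))))).mul ?_
  exact f.continuous.comp (continuous_prepend a)

theorem exists_norm_ruelleSum_le {𝕜 : Type*} [RCLike 𝕜] {r : ℕ} {β μ : ℝ}
    {A : ℕ → SymbolicSpace r → ℝ} (hlip : UniformlyLipschitz A) (hadm : Admissible β μ A) :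
    ∃ C : ℝ, 0 ≤ C ∧ ∀ (f : C(SymbolicSpace r, 𝕜)) (x : SymbolicSpace r),
      ‖ruelleSum β μ A f x‖ ≤ C * ‖f‖ := by
  obtain ⟨u, hu, hb⟩ := exists_weight_bound hlip hadm
  have hu' : Summable fun N => |u N| := hu.abs
  refine ⟨∑' N, |u N|, tsum_nonneg fun N => abs_nonneg _, fun f x => ?_⟩
  rw [← tsum_mul_right]
  refine tsum_of_norm_bounded (hu'.mul_right ‖f‖).hasSum fun N => ?_
  refine (norm_term_le β μ A f N x).trans ?_
  gcongr
  exact (hb N x).trans (le_abs_self _)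

/-- The grand-canonical Ruelle operator `L_{β,μ}` as a bounded operator on `C(Ω; 𝕜)`, `𝕜 = ℝ` or
`ℂ`. The operator for `𝕜 = ℂ` is the complexification of the one for `𝕜 = ℝ`. -/
noncomputable def grandCanonicalRuelle (𝕜 : Type*) [RCLike 𝕜] {r : ℕ} (β μ : ℝ)
    (A : ℕ → SymbolicSpace r → ℝ) (hlip : UniformlyLipschitz A) (hadm : Admissible β μ A) :
    C(SymbolicSpace r, 𝕜) →L[𝕜] C(SymbolicSpace r, 𝕜) :=
  LinearMap.mkContinuousOfExistsBound
    { toFun := fun f => ⟨ruelleSum β μ A f, continuous_ruelleSum hlip hadm f⟩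
      map_add' := fun f g => by
        ext x
        have := (summable_term hadm f x).tsum_add (summable_term hadm g x)
        simpa [ruelleSum, mul_add, Finset.sum_add_distrib] using this
      map_smul' := fun c f => by
        ext x
        have := (summable_term hadm f x).tsum_mul_left c
        simpa [ruelleSum, Finset.mul_sum, mul_left_comm] using this }
    (by
      obtain ⟨C, hC, h⟩ := exists_norm_ruelleSum_le (𝕜 := 𝕜) hlip hadm
      exact ⟨C, fun f => (ContinuousMap.norm_le _ (by positivity)).2 (h f)⟩)

theorem grandCanonicalRuelle_apply (𝕜 : Type*) [RCLike 𝕜] {r : ℕ} (β μ : ℝ)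
    (A : ℕ → SymbolicSpace r → ℝ) (hlip : UniformlyLipschitz A) (hadm : Admissible β μ A)
    (f : C(SymbolicSpace r, 𝕜)) (x : SymbolicSpace r) :
    grandCanonicalRuelle 𝕜 β μ A hlip hadm f x = ruelleSum β μ A f x := rfl

/-- The Banach-space dual `L* : C(Ω)* → C(Ω)*`, `L* φ = φ ∘ L`. -/
noncomputable def dualOperator {r : ℕ}
    (L : C(SymbolicSpace r, ℝ) →L[ℝ] C(SymbolicSpace r, ℝ)) :
    StrongDual ℝ C(SymbolicSpace r, ℝ) →L[ℝ] StrongDual ℝ C(SymbolicSpace r, ℝ) :=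
  (ContinuousLinearMap.compL ℝ C(SymbolicSpace r, ℝ) C(SymbolicSpace r, ℝ) ℝ).flip L

/-- A Borel probability measure as an element `g ↦ ∫ g dν` of `C(Ω)*`. -/
noncomputable def toDual {r : ℕ} (ν : ProbabilityMeasure (SymbolicSpace r)) :
    StrongDual ℝ C(SymbolicSpace r, ℝ) :=
  LinearMap.mkContinuous
    { toFun := fun g => ∫ x, g x ∂(ν : Measure (SymbolicSpace r))
      map_add' := fun f g => integral_add
        (f.continuous.integrable_of_hasCompactSupport (HasCompactSupport.of_compactSpace f))
        (g.continuous.integrable_of_hasCompactSupport (HasCompactSupport.of_compactSpace g))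
      map_smul' := fun c f => integral_const_mul c f }
    1 (fun f => by
      simpa using norm_integral_le_of_norm_le_const
        (μ := (ν : Measure (SymbolicSpace r))) (Eventually.of_forall f.norm_coe_le_norm))

theorem toDual_apply {r : ℕ} (ν : ProbabilityMeasure (SymbolicSpace r))
    (g : C(SymbolicSpace r, ℝ)) :
    toDual ν g = ∫ x, g x ∂(ν : Measure (SymbolicSpace r)) := rfl

end GrandCanonical

open GrandCanonical

namespace GrandCanonical

/-! Summing over `N` first turns the operator into an ordinary transfer operator `∑_a W(ax) f(ax)`,
and (H1) makes `log W` Lipschitz. Prepending a symbol halves distances, so the functions whose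
logarithm has Lipschitz constant `K` on cylinders (`LogRegular`) form an invariant class, for
suitable `K`. The iterates of `1` therefore have bounded distortion. Near-multiplicativity and
Fekete's lemma then place them between constant multiples of `lam ^ n` (`exists_growth_rate`). A
limit of Cesàro averages of the normalized iterates is a positive eigenfunction `h`
(`exists_eigenfunction`).

Conjugating by `h` gives a Markov operator. Its iterates of a continuous function are
equicontinuous, and every cylinder of length `n` is reached in `n` steps with probability bounded
below. The oscillation thus tends to zero and the iterates converge to a constant
(`exists_tendstoUniformly_transfer_pow`). Undoing the conjugation, `lam⁻ⁿ Lⁿ g` converges uniformly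
to a multiple of `h`. The coefficient is a positive linear functional of `g`, hence an eigenmeasure
by Riesz (`exists_eigenmeasure`). Uniqueness and the dual convergence follow from this limit; the
spectral radius is found by comparison with `h`. -/

theorem prepend_mem_cylinder {r : ℕ} {x y : SymbolicSpace r} {n : ℕ} (a : Fin r)
    (h : y ∈ PiNat.cylinder x n) : prepend a y ∈ PiNat.cylinder (prepend a x) (n + 1) := by
  rintro (_ | i) hi
  · rfl
  · exact h i (by omega)

theorem prepend_mem_cylinder_tail {r : ℕ} {x z : SymbolicSpace r} {n : ℕ}
    (h : x ∈ PiNat.cylinder (fun i => z (i + 1)) n) : prepend (z 0) x ∈ PiNat.cylinder z (n + 1) := by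
  rintro (_ | i) hi
  · rfl
  · exact h i (by omega)

/-- The transfer operator `f ↦ ∑_a q_a(x) f(ax)` with weights `q_a`. -/
def transfer {r : ℕ} (q : Fin r → SymbolicSpace r → ℝ) :
    Module.End ℝ (SymbolicSpace r → ℝ) where
  toFun f x := ∑ a, q a x * f (prepend a x)
  map_add' f g := by ext x; simp [mul_add, Finset.sum_add_distrib]
  map_smul' c f := by ext x; simp [Finset.mul_sum, mul_left_comm]

theorem transfer_apply {r : ℕ} (q : Fin r → SymbolicSpace r → ℝ) (f : SymbolicSpace r → ℝ)
    (x : SymbolicSpace r) : transfer q f x = ∑ a, q a x * f (prepend a x) := rfl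

/-- `log f` varies by at most `K 2⁻ⁿ` on cylinders of length `n` (for positive `f`). -/
def LogRegular {r : ℕ} (K : ℝ) (f : SymbolicSpace r → ℝ) : Prop :=
  ∀ n x y, y ∈ PiNat.cylinder x n → f x ≤ Real.exp (K * (1 / 2) ^ n) * f y

/-! ### Distortion and continuity under a transfer operator. -/

section Transfer

variable {r : ℕ} {q : Fin r → SymbolicSpace r → ℝ}

theorem transfer_mono (hq : ∀ a x, 0 < q a x) {f g : SymbolicSpace r → ℝ} (h : f ≤ g) :
    transfer q f ≤ transfer q g := fun x => by
  rw [transfer_apply, transfer_apply]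
  exact Finset.sum_le_sum fun a _ => mul_le_mul_of_nonneg_left (h _) (hq a x).le

theorem transfer_pow_mono (hq : ∀ a x, 0 < q a x) (n : ℕ) {f g : SymbolicSpace r → ℝ}
    (h : f ≤ g) : (transfer q ^ n) f ≤ (transfer q ^ n) g := by
  induction n with
  | zero => simpa using h
  | succ n ih => simpa only [pow_succ', Module.End.mul_apply] using transfer_mono hq ih

theorem transfer_pos (hr : 0 < r) (hq : ∀ a x, 0 < q a x) {f : SymbolicSpace r → ℝ}
    (h : ∀ x, 0 < f x) (x : SymbolicSpace r) : 0 < transfer q f x := by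
  have : Nonempty (Fin r) := ⟨⟨0, hr⟩⟩
  exact Finset.sum_pos (fun a _ => mul_pos (hq a x) (h _)) Finset.univ_nonempty

theorem transfer_pow_pos (hr : 0 < r) (hq : ∀ a x, 0 < q a x) (n : ℕ) {f : SymbolicSpace r → ℝ}
    (h : ∀ x, 0 < f x) : ∀ x, 0 < (transfer q ^ n) f x := by
  induction n with
  | zero => simpa using h
  | succ n ih => simpa only [pow_succ', Module.End.mul_apply] using transfer_pos hr hq ih

/-- The weights contribute `K / 2`, and `f`, evaluated on cylinders one symbol longer, contributes
another `K / 2`. This is why the weights are required to be regular with half the constant. -/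
theorem LogRegular.transfer {K : ℝ} (hq : ∀ a x, 0 < q a x) (hK : ∀ a, LogRegular (K / 2) (q a))
    {f : SymbolicSpace r → ℝ} (hf : LogRegular K f) (hpos : ∀ x, 0 < f x) :
    LogRegular K (transfer q f) := by
  intro n x y hxy
  rw [transfer_apply, transfer_apply, Finset.mul_sum]
  refine Finset.sum_le_sum fun a _ => ?_
  calc q a x * f (prepend a x)
      ≤ (Real.exp (K / 2 * (1 / 2) ^ n) * q a y) *
        (Real.exp (K * (1 / 2) ^ (n + 1)) * f (prepend a y)) :=
        mul_le_mul (hK a n x y hxy) (hf _ _ _ (prepend_mem_cylinder a hxy)) (hpos _).le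
          (mul_nonneg (Real.exp_pos _).le (hq a y).le)
    _ = Real.exp (K / 2 * (1 / 2) ^ n + K * (1 / 2) ^ (n + 1)) *
        (q a y * f (prepend a y)) := by rw [Real.exp_add]; ring
    _ = _ := by congr 2; ring

theorem LogRegular.transfer_pow (hr : 0 < r) {K : ℝ} (hq : ∀ a x, 0 < q a x)
    (hK : ∀ a, LogRegular (K / 2) (q a)) {f : SymbolicSpace r → ℝ} (hf : LogRegular K f)
    (hpos : ∀ x, 0 < f x) (n : ℕ) : LogRegular K ((GrandCanonical.transfer q ^ n) f) := by
  induction n with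
  | zero => simpa using hf
  | succ n ih =>
    simpa only [pow_succ', Module.End.mul_apply] using
      ih.transfer hq hK (transfer_pow_pos hr hq n hpos)

theorem LogRegular.one {K : ℝ} (hK : 0 ≤ K) : LogRegular K (1 : SymbolicSpace r → ℝ) :=
  fun n x y _ => by
    simpa only [Pi.one_apply, mul_one] using
      Real.one_le_exp (mul_nonneg hK (by positivity : (0 : ℝ) ≤ (1 / 2) ^ n))

theorem LogRegular.le_exp_mul {K : ℝ} {f : SymbolicSpace r → ℝ} (hf : LogRegular K f)
    (x y : SymbolicSpace r) : f x ≤ Real.exp K * f y := by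
  simpa using hf 0 x y (by simp)

theorem LogRegular.abs_sub_le {K B : ℝ} (hK : 0 ≤ K) {f : SymbolicSpace r → ℝ}
    (hf : LogRegular K f) (hB : ∀ x, |f x| ≤ B) {n : ℕ} {x y : SymbolicSpace r}
    (h : y ∈ PiNat.cylinder x n) : |f x - f y| ≤ K * Real.exp K * B * (1 / 2) ^ n := by
  have key : ∀ x y, y ∈ PiNat.cylinder x n → f x - f y ≤ K * Real.exp K * B * (1 / 2) ^ n := by
    intro x y h
    have h1 := hf n x y h
    set t : ℝ := (1 / 2) ^ n
    have ht0 : 0 ≤ t := by positivity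
    have ht1 : t ≤ 1 := pow_le_one₀ (by norm_num) (by norm_num)
    -- With `s = K * t`, multiplying `1 - s ≤ e⁻ˢ` by `eˢ` gives `eˢ - 1 ≤ s eˢ`, and `s ≤ K`.
    have h2 : Real.exp (K * t) - 1 ≤ K * t * Real.exp K := by
      have h3 := Real.add_one_le_exp (-(K * t))
      have h4 : Real.exp (K * t) ≤ Real.exp K := Real.exp_le_exp.2 (by nlinarith)
      have h5 : Real.exp (-(K * t)) * Real.exp (K * t) = 1 := by
        rw [← Real.exp_add]; simp
      nlinarith [Real.exp_pos (K * t), mul_nonneg hK ht0]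
    have h6 : 0 ≤ Real.exp (K * t) - 1 := by
      have := Real.add_one_le_exp (K * t)
      nlinarith [mul_nonneg hK ht0]
    calc f x - f y ≤ (Real.exp (K * t) - 1) * f y := by linarith
      _ ≤ (Real.exp (K * t) - 1) * B :=
        mul_le_mul_of_nonneg_left ((le_abs_self _).trans (hB y)) h6
      _ ≤ (K * t * Real.exp K) * B :=
        mul_le_mul_of_nonneg_right h2 ((abs_nonneg _).trans (hB y))
      _ = _ := by ring
  rw [abs_le]
  have h' : x ∈ PiNat.cylinder y n := (PiNat.mem_cylinder_comm _ _ _).1 h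
  constructor
  · linarith [key y x h']
  · exact key x y h

theorem continuous_of_abs_sub_le {C : ℝ} {f : SymbolicSpace r → ℝ}
    (hf : ∀ n x y, y ∈ PiNat.cylinder x n → |f x - f y| ≤ C * (1 / 2) ^ n) : Continuous f := by
  rw [continuous_iff_continuousAt]
  intro x
  rw [ContinuousAt, Metric.tendsto_nhds]
  intro ε hε
  have h0 : Tendsto (fun n : ℕ => C * (1 / 2 : ℝ) ^ n) atTop (𝓝 0) := by
    simpa using (tendsto_pow_atTop_nhds_zero_of_lt_one (r := (1 / 2 : ℝ)) (by norm_num)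
      (by norm_num)).const_mul C
  obtain ⟨n, hn⟩ := (h0.eventually_lt_const hε).exists
  filter_upwards [(PiNat.isOpen_cylinder (fun _ : ℕ => Fin r) x n).mem_nhds
    (PiNat.self_mem_cylinder x n)] with y hy
  rw [dist_comm, Real.dist_eq]
  exact (hf n x y hy).trans_lt hn

theorem LogRegular.continuous {K : ℝ} (hK : 0 ≤ K) {f : SymbolicSpace r → ℝ}
    (hf : LogRegular K f) (hpos : ∀ x, 0 < f x) : Continuous f := by
  rcases isEmpty_or_nonempty (SymbolicSpace r) with he | ⟨⟨x₀⟩⟩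
  · exact continuous_of_const fun x => he.elim x
  · refine continuous_of_abs_sub_le (C := K * Real.exp K * (Real.exp K * f x₀)) fun n x y h => ?_
    exact hf.abs_sub_le hK (fun x => by rw [abs_of_pos (hpos x)]; exact hf.le_exp_mul x x₀) h

/-- Uniform continuity by compactness: for `N` the largest length in a finite subcover by cylinders,
points sharing `N` symbols lie in a common member of it. -/
theorem exists_abs_sub_le_of_mem_cylinder {f : SymbolicSpace r → ℝ} (hf : Continuous f)
    {ε : ℝ} (hε : 0 < ε) :
    ∃ N, ∀ x y, y ∈ PiNat.cylinder x N → |f x - f y| ≤ ε := by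
  have hloc : ∀ x, ∃ n, ∀ y ∈ PiNat.cylinder x n, |f y - f x| < ε / 2 := by
    intro x
    have h1 : {y | |f y - f x| < ε / 2} ∈ 𝓝 x :=
      Metric.tendsto_nhds.1 (hf.tendsto x) (ε / 2) (by positivity)
    obtain ⟨_, ⟨z, n, rfl⟩, hx, hsub⟩ :=
      (PiNat.isTopologicalBasis_cylinders (fun _ : ℕ => Fin r)).mem_nhds_iff.1 h1
    refine ⟨n, fun y hy => hsub ?_⟩
    rwa [← PiNat.mem_cylinder_iff_eq.1 hx]
  choose n hn using hloc
  obtain ⟨t, ht⟩ := CompactSpace.elim_nhds_subcover (fun x : SymbolicSpace r => PiNat.cylinder x (n x))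
    fun x => (PiNat.isOpen_cylinder (fun _ : ℕ => Fin r) x _).mem_nhds
      (PiNat.self_mem_cylinder x _)
  refine ⟨t.sup n, fun x y hxy => ?_⟩
  have hx : x ∈ ⋃ z ∈ t, PiNat.cylinder z (n z) := by rw [ht]; trivial
  simp only [Set.mem_iUnion] at hx
  obtain ⟨z, hz, hxz⟩ := hx
  have hyz : y ∈ PiNat.cylinder z (n z) := by
    rw [← PiNat.mem_cylinder_iff_eq.1 hxz]
    exact PiNat.cylinder_anti x (Finset.le_sup hz) hxy
  have h1 := hn z x hxz
  have h2 := hn z y hyz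
  rw [abs_lt] at h1 h2
  rw [abs_le]
  constructor <;> linarith [h1.1, h1.2, h2.1, h2.2]

end Transfer

/-! ### Mixing for Markov transfer operators. -/

section Markov

variable {r : ℕ} {q : Fin r → SymbolicSpace r → ℝ}

theorem transfer_const (hsum : ∀ x, ∑ a, q a x = 1) (c : ℝ) (x : SymbolicSpace r) :
    transfer q (fun _ => c) x = c := by
  rw [transfer_apply, ← Finset.sum_mul, hsum, one_mul]

theorem transfer_le_of_le (hq : ∀ a x, 0 < q a x) (hsum : ∀ x, ∑ a, q a x = 1)
    {f : SymbolicSpace r → ℝ} {b : ℝ} (h : ∀ x, f x ≤ b) (x : SymbolicSpace r) :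
    transfer q f x ≤ b :=
  (transfer_mono hq (g := fun _ => b) h x).trans_eq (transfer_const hsum b x)

theorem le_transfer_of_le (hq : ∀ a x, 0 < q a x) (hsum : ∀ x, ∑ a, q a x = 1)
    {f : SymbolicSpace r → ℝ} {b : ℝ} (h : ∀ x, b ≤ f x) (x : SymbolicSpace r) :
    b ≤ transfer q f x :=
  (transfer_const hsum b x).symm.trans_le (transfer_mono hq (f := fun _ => b) h x)

theorem abs_transfer_pow_le (hq : ∀ a x, 0 < q a x) (hsum : ∀ x, ∑ a, q a x = 1)
    {f : SymbolicSpace r → ℝ} {B : ℝ} (h : ∀ x, |f x| ≤ B) (n : ℕ) :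
    ∀ x, |(transfer q ^ n) f x| ≤ B := by
  induction n with
  | zero => simpa using h
  | succ n ih =>
    intro x
    simp only [pow_succ', Module.End.mul_apply]
    exact abs_le.2 ⟨le_transfer_of_le hq hsum (fun x => (abs_le.1 (ih x)).1) x,
      transfer_le_of_le hq hsum (fun x => (abs_le.1 (ih x)).2) x⟩

/-- The iterates of a continuous function under a Markov transfer operator with Lipschitz weights
are equicontinuous. -/
theorem exists_abs_transfer_pow_sub_le (hq : ∀ a x, 0 < q a x) (hsum : ∀ x, ∑ a, q a x = 1)
    {C : ℝ} (hC : ∀ a n x y, y ∈ PiNat.cylinder x n → |q a x - q a y| ≤ C * (1 / 2) ^ n)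
    {f : SymbolicSpace r → ℝ} (hf : Continuous f) {ε : ℝ} (hε : 0 < ε) :
    ∃ D : ℝ, ∀ k n x y, y ∈ PiNat.cylinder x n →
      |(transfer q ^ k) f x - (transfer q ^ k) f y| ≤ ε + D * (1 / 2) ^ n := by
  obtain ⟨B, hB⟩ : ∃ B, ∀ x, |f x| ≤ B := by
    obtain ⟨B, hB⟩ := isCompact_univ.exists_bound_of_continuousOn hf.continuousOn
    exact ⟨B, fun x => hB x trivial⟩
  obtain ⟨N, hN⟩ := exists_abs_sub_le_of_mem_cylinder hf hε
  -- The first entry serves `k = 0`: for `n < N` the trivial bound `2B` is at most `2B 2^N 2⁻ⁿ`. The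
  -- second makes the induction close: the old error is halved and the variation of the weights adds
  -- at most `D / 2`.
  refine ⟨max (2 * B * 2 ^ N) (2 * (r * C * B)), fun k => ?_⟩
  set D := max (2 * B * 2 ^ N) (2 * (r * C * B)) with hD
  have hD1 : 2 * B * 2 ^ N ≤ D := le_max_left _ _
  have hD2 : 2 * (r * C * B) ≤ D := le_max_right _ _
  induction k with
  | zero =>
    intro n x y h
    have hB0 : 0 ≤ B := (abs_nonneg _).trans (hB x)
    simp only [pow_zero, Module.End.one_apply]
    rcases le_total N n with hn | hn
    · have : 0 ≤ D * (1 / 2) ^ n :=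
        mul_nonneg ((by positivity : (0 : ℝ) ≤ 2 * B * 2 ^ N).trans hD1) (by positivity)
      linarith [hN x y (PiNat.cylinder_anti x hn h)]
    · have h1 : |f x - f y| ≤ 2 * B := by
        have := abs_sub (f x) (f y)
        linarith [hB x, hB y]
      have h2 : 2 * B ≤ D * (1 / 2) ^ n := by
        calc 2 * B = (2 * B * 2 ^ N) * (1 / 2) ^ N := by
              rw [mul_assoc, ← mul_pow]; norm_num
          _ ≤ (2 * B * 2 ^ N) * (1 / 2) ^ n := by
              refine mul_le_mul_of_nonneg_left ?_ (by positivity)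
              exact pow_le_pow_of_le_one (by norm_num) (by norm_num) hn
          _ ≤ _ := by gcongr
      linarith
  | succ k ih =>
    intro n x y h
    simp only [pow_succ', Module.End.mul_apply]
    set g := (transfer q ^ k) f
    have hg : ∀ x, |g x| ≤ B := abs_transfer_pow_le hq hsum hB k
    have h1 : transfer q g x - transfer q g y =
        ∑ a, q a x * (g (prepend a x) - g (prepend a y)) +
          ∑ a, (q a x - q a y) * g (prepend a y) := by
      rw [transfer_apply, transfer_apply, ← Finset.sum_sub_distrib, ← Finset.sum_add_distrib]
      exact Finset.sum_congr rfl fun a _ => by ring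
    have h2 : |∑ a, q a x * (g (prepend a x) - g (prepend a y))| ≤
        ε + D * (1 / 2) ^ (n + 1) := by
      calc _ ≤ ∑ a, q a x * (ε + D * (1 / 2) ^ (n + 1)) := by
            refine (Finset.abs_sum_le_sum_abs _ _).trans (Finset.sum_le_sum fun a _ => ?_)
            rw [abs_mul, abs_of_pos (hq a x)]
            exact mul_le_mul_of_nonneg_left (ih _ _ _ (prepend_mem_cylinder a h)) (hq a x).le
        _ = _ := by rw [← Finset.sum_mul, hsum, one_mul]
    have h3 : |∑ a, (q a x - q a y) * g (prepend a y)| ≤ r * C * B * (1 / 2) ^ n := by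
      calc _ ≤ ∑ _a : Fin r, C * (1 / 2) ^ n * B := by
            refine (Finset.abs_sum_le_sum_abs _ _).trans (Finset.sum_le_sum fun a _ => ?_)
            rw [abs_mul]
            exact mul_le_mul (hC a n x y h) (hg _) (abs_nonneg _)
              ((abs_nonneg _).trans (hC a n x y h))
        _ = _ := by simp; ring
    rw [h1]
    refine (abs_add_le _ _).trans ((add_le_add h2 h3).trans ?_)
    have h4 : r * C * B * (1 / 2 : ℝ) ^ n ≤ D / 2 * (1 / 2) ^ n := by
      gcongr; linarith
    rw [pow_succ]
    linarith

/-- A bound on a cylinder of length `n` improves the global bound after `n` steps. -/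
theorem transfer_pow_le_sub (hq : ∀ a x, 0 < q a x) (hsum : ∀ x, ∑ a, q a x = 1) {δ : ℝ}
    (hδ0 : 0 ≤ δ) (hδ : ∀ a x, δ ≤ q a x) (n : ℕ) :
    ∀ {g : SymbolicSpace r → ℝ} {z : SymbolicSpace r} {b d : ℝ}, 0 ≤ d → (∀ x, g x ≤ b) →
      (∀ x ∈ PiNat.cylinder z n, g x ≤ b - d) → ∀ x, (transfer q ^ n) g x ≤ b - δ ^ n * d := by
  induction n with
  | zero => intro g z b d _ _ h x; simpa using h x (by simp)
  | succ n ih =>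
    intro g z b d hd hb hz x
    rw [pow_succ, Module.End.mul_apply, pow_succ, mul_assoc]
    -- One step moves the deficit to the tail cylinder: from there the branch `z 0` leads into the
    -- cylinder of `z` with weight at least `δ`, leaving a deficit `δ * d`.
    refine ih (z := fun i => z (i + 1)) (mul_nonneg hδ0 hd) (transfer_le_of_le hq hsum hb)
      (fun y hy => ?_) x
    have h1 : b - transfer q g y = ∑ a, q a y * (b - g (prepend a y)) := by
      rw [transfer_apply]
      simp only [mul_sub, Finset.sum_sub_distrib, ← Finset.sum_mul, hsum, one_mul]
    have h2 : q (z 0) y * (b - g (prepend (z 0) y)) ≤ b - transfer q g y := by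
      rw [h1]
      exact Finset.single_le_sum (f := fun a => q a y * (b - g (prepend a y)))
        (fun a _ => mul_nonneg (hq a y).le (sub_nonneg.2 (hb _))) (Finset.mem_univ _)
    have h3 := hz _ (prepend_mem_cylinder_tail hy)
    have h4 : δ * d ≤ q (z 0) y * (b - g (prepend (z 0) y)) :=
      mul_le_mul (hδ _ _) (by linarith) hd (hq _ _).le
    linarith

/-- The iterates of a continuous function under a Markov transfer operator with Lipschitz positive
weights converge uniformly to a constant. -/
theorem exists_tendstoUniformly_transfer_pow (hr : 0 < r) (hq : ∀ a x, 0 < q a x)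
    (hsum : ∀ x, ∑ a, q a x = 1) {δ : ℝ} (hδ0 : 0 < δ) (hδ : ∀ a x, δ ≤ q a x)
    {C : ℝ} (hC : ∀ a n x y, y ∈ PiNat.cylinder x n → |q a x - q a y| ≤ C * (1 / 2) ^ n)
    {f : SymbolicSpace r → ℝ} (hf : Continuous f) :
    ∃ m : ℝ, TendstoUniformly (fun n => (transfer q ^ n) f) (fun _ => m) atTop := by
  have : Nonempty (SymbolicSpace r) := ⟨fun _ => ⟨0, hr⟩⟩
  obtain ⟨B, hB⟩ : ∃ B, ∀ x, |f x| ≤ B := by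
    obtain ⟨B, hB⟩ := isCompact_univ.exists_bound_of_continuousOn hf.continuousOn
    exact ⟨B, fun x => hB x trivial⟩
  set g : ℕ → SymbolicSpace r → ℝ := fun n => (transfer q ^ n) f with hg
  have hgB : ∀ n x, |g n x| ≤ B := fun n => abs_transfer_pow_le hq hsum hB n
  have hgs : ∀ n, g (n + 1) = transfer q (g n) := fun n => by
    simp only [hg, pow_succ', Module.End.mul_apply]
  have hga : ∀ n k, g (k + n) = (transfer q ^ n) (g k) := fun n k => by
    simp only [hg, ← Module.End.mul_apply, ← pow_add, add_comm]
  have bdA : ∀ n, BddAbove (Set.range (g n)) := fun n =>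
    ⟨B, by rintro _ ⟨x, rfl⟩; exact (abs_le.1 (hgB n x)).2⟩
  have bdB : ∀ n, BddBelow (Set.range (g n)) := fun n =>
    ⟨-B, by rintro _ ⟨x, rfl⟩; exact (abs_le.1 (hgB n x)).1⟩
  set s : ℕ → ℝ := fun n => ⨆ x, g n x with hs
  set i : ℕ → ℝ := fun n => ⨅ x, g n x with hi
  have hle_s : ∀ n x, g n x ≤ s n := fun n x => le_ciSup (bdA n) x
  have hi_le : ∀ n x, i n ≤ g n x := fun n x => ciInf_le (bdB n) x
  have s_anti : Antitone s := antitone_nat_of_succ_le fun n => by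
    refine ciSup_le fun x => ?_
    rw [hgs]; exact transfer_le_of_le hq hsum (hle_s n) x
  have i_mono : Monotone i := monotone_nat_of_le_succ fun n => by
    refine le_ciInf fun x => ?_
    rw [hgs]; exact le_transfer_of_le hq hsum (hi_le n) x
  have x₀ : SymbolicSpace r := Classical.arbitrary _
  have sBdd : BddBelow (Set.range s) := ⟨-B, by
    rintro _ ⟨n, rfl⟩; exact (abs_le.1 (hgB n x₀)).1.trans (hle_s n x₀)⟩
  have iBdd : BddAbove (Set.range i) := ⟨B, by
    rintro _ ⟨n, rfl⟩; exact (hi_le n x₀).trans (abs_le.1 (hgB n x₀)).2⟩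
  have hsT := tendsto_atTop_ciInf s_anti sBdd
  have hiT := tendsto_atTop_ciSup i_mono iBdd
  set S := ⨅ n, s n
  set I := ⨆ n, i n
  have hIS : I ≤ S := le_of_tendsto_of_tendsto' hiT hsT fun n => (hi_le n x₀).trans (hle_s n x₀)
  -- By equicontinuity one length `n` serves all `k`: `g k` is within `ε` of its infimum on some
  -- `n`-cylinder. Hence `n` more steps lower the supremum by `δ ^ n * (s k - i k - ε)`. Letting `k
  -- → ∞` forces `S - I ≤ ε`.
  have hSI : S ≤ I := by
    refine le_of_forall_pos_le_add fun ε hε => ?_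
    obtain ⟨D, hD⟩ := exists_abs_transfer_pow_sub_le hq hsum hC hf (by positivity : 0 < ε / 3)
    have h0 : Tendsto (fun n : ℕ => D * (1 / 2 : ℝ) ^ n) atTop (𝓝 0) := by
      simpa using (tendsto_pow_atTop_nhds_zero_of_lt_one (r := (1 / 2 : ℝ)) (by norm_num)
        (by norm_num)).const_mul D
    obtain ⟨n, hn⟩ := (h0.eventually_lt_const (by positivity : 0 < ε / 3)).exists
    have key : ∀ k, s (k + n) ≤ s k - δ ^ n * (s k - i k - ε) := by
      intro k
      obtain ⟨z, hz⟩ := exists_lt_of_ciInf_lt (show (⨅ x, g k x) < i k + ε / 3 by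
        simp only [hi]; linarith)
      have hcyl : ∀ x ∈ PiNat.cylinder z n, g k x ≤ i k + ε := by
        intro x hx
        have := (abs_le.1 (hD k n z x hx)).1
        simp only [hg] at hz ⊢
        linarith
      -- The maximum with `0` supplies the nonnegative deficit that `transfer_pow_le_sub` needs.
      have h1 : ∀ x, g (k + n) x ≤ s k - δ ^ n * max 0 (s k - i k - ε) := by
        intro x
        rw [hga]
        refine transfer_pow_le_sub hq hsum hδ0.le hδ n (z := z) (le_max_left _ _) (hle_s k)
          (fun x hx => ?_) x
        rcases max_cases 0 (s k - i k - ε) with h | h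
        · rw [h.1]; simpa using hle_s k x
        · rw [h.1]; linarith [hcyl x hx]
      have h2 : s (k + n) ≤ s k - δ ^ n * max 0 (s k - i k - ε) := ciSup_le h1
      have h3 : δ ^ n * (s k - i k - ε) ≤ δ ^ n * max 0 (s k - i k - ε) := by
        gcongr; exact le_max_right _ _
      linarith
    have hlim : S ≤ S - δ ^ n * (S - I - ε) :=
      le_of_tendsto_of_tendsto' (hsT.comp (tendsto_add_atTop_nat n))
        (hsT.sub (((hsT.sub hiT).sub_const ε).const_mul _)) key
    have : 0 < δ ^ n := by positivity
    by_contra! hcon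
    nlinarith
  have hEq : I = S := le_antisymm hIS hSI
  rw [hEq] at hiT
  refine ⟨S, ?_⟩
  rw [Metric.tendstoUniformly_iff]
  intro ε hε
  filter_upwards [hsT.eventually_lt_const (show S < S + ε by linarith),
    hiT.eventually_const_lt (show S - ε < S by linarith)] with n h1 h2 x
  rw [dist_comm, Real.dist_eq, abs_lt]
  exact ⟨by linarith [hi_le n x], by linarith [hle_s n x]⟩

end Markov

/-! ### Almost additive sequences. -/

/-- Both `u + K` and `K - u` are subadditive, and their Fekete limits are opposite because their sum
is the constant `2K`. As each limit is an infimum, the two give the two bounds. -/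
theorem exists_abs_sub_nat_mul_le {u : ℕ → ℝ} {K : ℝ}
    (h : ∀ m n, |u (m + n) - u m - u n| ≤ K) : ∃ l : ℝ, ∀ n : ℕ, |u n - n * l| ≤ K := by
  have hK : 0 ≤ K := (abs_nonneg _).trans (h 0 0)
  have ha : Subadditive fun n => u n + K := fun m n => by
    have := (abs_le.1 (h m n)).2; dsimp only; linarith
  have hb : Subadditive fun n => K - u n := fun m n => by
    have := (abs_le.1 (h m n)).1; dsimp only; linarith
  -- Linear growth keeps the quotients in Fekete's lemma bounded below.
  have hlin : ∀ n : ℕ, |u n| ≤ K + n * (K + |u 1|) := by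
    intro n
    induction n with
    | zero => have := h 0 0; simp at this; simpa using this
    | succ n ih =>
      have h1 : u (n + 1) = (u (n + 1) - u n - u 1) + u n + u 1 := by ring
      rw [h1]
      refine (abs_add_three _ _ _).trans ?_
      push_cast
      linarith [h n 1]
  have bdd : ∀ w : ℕ → ℝ, (∀ n, -|u n| ≤ w n) →
      BddBelow (Set.range fun n : ℕ => w n / n) := by
    intro w hw
    refine ⟨-(2 * K + |u 1|), ?_⟩
    rintro _ ⟨n, rfl⟩
    dsimp only
    rcases n.eq_zero_or_pos with rfl | hn
    · simpa using by linarith [abs_nonneg (u 1)]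
    · have hn' : (1 : ℝ) ≤ n := by exact_mod_cast hn
      rw [le_div_iff₀ (by linarith)]
      nlinarith [hw n, hlin n, abs_nonneg (u 1)]
  have bda := bdd (fun n => u n + K) fun n => by linarith [neg_abs_le (u n)]
  have bdb := bdd (fun n => K - u n) fun n => by linarith [le_abs_self (u n)]
  have ta := ha.tendsto_lim bda
  have tb := hb.tendsto_lim bdb
  have hsum : ha.lim + hb.lim = 0 := by
    refine tendsto_nhds_unique (ta.add tb) ?_
    have := tendsto_const_div_atTop_nhds_zero_nat (2 * K)
    refine this.congr fun n => ?_
    rw [← add_div]; congr 1; ring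
  refine ⟨ha.lim, fun n => ?_⟩
  rcases n.eq_zero_or_pos with rfl | hn
  · simpa using hlin 0
  · have hn' : (0 : ℝ) < n := by exact_mod_cast hn
    have h1 := ha.lim_le_div bda hn.ne'
    have h2 := hb.lim_le_div bdb hn.ne'
    rw [le_div_iff₀ hn'] at h1 h2
    rw [abs_le]
    have h3 : hb.lim = -ha.lim := by linarith
    rw [h3] at h2
    constructor <;> linarith

/-! ### Positive eigenfunction and convergence of normalized iterates. -/

section Perron

variable {r : ℕ} {q : Fin r → SymbolicSpace r → ℝ}

theorem tendsto_transfer_apply {ι : Type*} {l : Filter ι}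
    {F : ι → SymbolicSpace r → ℝ} {g : SymbolicSpace r → ℝ}
    (h : ∀ x, Tendsto (fun i => F i x) l (𝓝 (g x))) (x : SymbolicSpace r) :
    Tendsto (fun i => transfer q (F i) x) l (𝓝 (transfer q g x)) := by
  simp only [transfer_apply]
  exact tendsto_finsetSum _ fun a _ => (h (prepend a x)).const_mul (q a x)

/-- Bounded distortion makes `log (v n)` almost additive with error `K`. The `2 * K` collects this
error and the distortion between `x` and `x₀`. -/
theorem exists_growth_rate (hr : 0 < r) {K : ℝ} (hK0 : 0 ≤ K) (hq : ∀ a x, 0 < q a x)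
    (hK : ∀ a, LogRegular (K / 2) (q a)) :
    ∃ lam : ℝ, 0 < lam ∧ ∀ n x, Real.exp (-(2 * K)) * lam ^ n ≤ (transfer q ^ n) 1 x ∧
      (transfer q ^ n) 1 x ≤ Real.exp (2 * K) * lam ^ n := by
  have x₀ : SymbolicSpace r := fun _ => ⟨0, hr⟩
  set v : ℕ → ℝ := fun n => (transfer q ^ n) 1 x₀ with hv
  have hpos : ∀ n x, 0 < (transfer q ^ n) 1 x := fun n =>
    transfer_pow_pos hr hq n fun _ => one_pos
  have hreg : ∀ n, LogRegular K ((transfer q ^ n) 1) := fun n =>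
    (LogRegular.one hK0).transfer_pow hr hq hK (fun _ => one_pos) n
  have hup : ∀ n x, (transfer q ^ n) 1 x ≤ Real.exp K * v n := fun n x =>
    (hreg n).le_exp_mul x x₀
  have hlow : ∀ n x, Real.exp (-K) * v n ≤ (transfer q ^ n) 1 x := fun n x => by
    rw [Real.exp_neg, inv_mul_le_iff₀ (Real.exp_pos K)]
    exact (hreg n).le_exp_mul x₀ x
  have h1 : ∀ m n, v (m + n) ≤ Real.exp K * v n * v m := by
    intro m n
    have := transfer_pow_mono hq m (f := (transfer q ^ n) 1)
      (g := (Real.exp K * v n) • (1 : SymbolicSpace r → ℝ))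
      (fun x => by simpa using hup n x) x₀
    rwa [map_smul, ← Module.End.mul_apply, ← pow_add, Pi.smul_apply, smul_eq_mul] at this
  have h2 : ∀ m n, Real.exp (-K) * v n * v m ≤ v (m + n) := by
    intro m n
    have := transfer_pow_mono hq m (g := (transfer q ^ n) 1)
      (f := (Real.exp (-K) * v n) • (1 : SymbolicSpace r → ℝ))
      (fun x => by simpa using hlow n x) x₀
    rwa [map_smul, ← Module.End.mul_apply, ← pow_add, Pi.smul_apply, smul_eq_mul] at this
  have hvpos : ∀ n, 0 < v n := fun n => hpos n x₀
  obtain ⟨l, hl⟩ := exists_abs_sub_nat_mul_le (u := fun n => Real.log (v n)) (K := K) <| by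
    intro m n
    have e1 := Real.log_le_log (hvpos _) (h1 m n)
    have e2 := Real.log_le_log
      (mul_pos (mul_pos (Real.exp_pos _) (hvpos _)) (hvpos _)) (h2 m n)
    rw [Real.log_mul (mul_pos (Real.exp_pos _) (hvpos _)).ne' (hvpos _).ne',
      Real.log_mul (Real.exp_pos _).ne' (hvpos _).ne', Real.log_exp] at e1 e2
    rw [abs_le]
    constructor <;> linarith
  refine ⟨Real.exp l, Real.exp_pos l, fun n x => ?_⟩
  have h3 := abs_le.1 (hl n)
  have hvn : v n = Real.exp (Real.log (v n)) := (Real.exp_log (hvpos n)).symm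
  rw [← Real.exp_nat_mul, ← Real.exp_add, ← Real.exp_add]
  constructor
  · refine le_trans ?_ (hlow n x)
    rw [hvn, ← Real.exp_add]
    exact Real.exp_le_exp.2 (by linarith [h3.1])
  · refine (hup n x).trans ?_
    rw [hvn, ← Real.exp_add]
    exact Real.exp_le_exp.2 (by linarith [h3.2])

/-- A positive eigenfunction, as a limit along an ultrafilter of Cesàro averages of normalized
iterates. -/
theorem exists_eigenfunction (hr : 0 < r) {K : ℝ} (hK0 : 0 ≤ K) (hq : ∀ a x, 0 < q a x)
    (hK : ∀ a, LogRegular (K / 2) (q a)) :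
    ∃ lam : ℝ, 0 < lam ∧ ∃ h : SymbolicSpace r → ℝ, (∀ x, 0 < h x) ∧ LogRegular K h ∧
      transfer q h = lam • h := by
  obtain ⟨lam, hlam, hb⟩ := exists_growth_rate hr hK0 hq hK
  refine ⟨lam, hlam, ?_⟩
  set u : ℕ → SymbolicSpace r → ℝ := fun n => (lam ^ n)⁻¹ • (transfer q ^ n) 1 with hu
  have hu1 : ∀ n x, Real.exp (-(2 * K)) ≤ u n x := fun n x => by
    simp only [hu, Pi.smul_apply, smul_eq_mul]
    rw [le_inv_mul_iff₀ (by positivity), mul_comm]; exact (hb n x).1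
  have hu2 : ∀ n x, u n x ≤ Real.exp (2 * K) := fun n x => by
    simp only [hu, Pi.smul_apply, smul_eq_mul]
    rw [inv_mul_le_iff₀ (by positivity), mul_comm]; exact (hb n x).2
  have hreg : ∀ n, LogRegular K (u n) := fun n k x y hxy => by
    have := (LogRegular.one hK0).transfer_pow hr hq hK (fun _ => one_pos) n k x y hxy
    simp only [hu, Pi.smul_apply, smul_eq_mul]
    rw [mul_left_comm]
    exact mul_le_mul_of_nonneg_left this (by positivity)
  have hus : ∀ n, transfer q (u n) = lam • u (n + 1) := fun n => by
    simp only [hu]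
    rw [map_smul, ← Module.End.mul_apply, ← pow_succ', smul_smul]
    congr 1
    field_simp
    ring
  set F : ℕ → SymbolicSpace r → ℝ :=
    fun n => ((n : ℝ) + 1)⁻¹ • ∑ k ∈ Finset.range (n + 1), u k with hF
  have hFx : ∀ n x, F n x = ((n : ℝ) + 1)⁻¹ * ∑ k ∈ Finset.range (n + 1), u k x := fun n x => by
    simp [hF, Finset.sum_apply]
  have hmem : ∀ n, F n ∈ Set.univ.pi fun _ : SymbolicSpace r =>
      Set.Icc (Real.exp (-(2 * K))) (Real.exp (2 * K)) := by
    intro n x _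
    rw [hFx]
    have hn : (0 : ℝ) < n + 1 := by positivity
    constructor
    · rw [le_inv_mul_iff₀ hn]
      simpa using Finset.card_nsmul_le_sum (Finset.range (n + 1)) (fun k => u k x) _
        fun k _ => hu1 k x
    · rw [inv_mul_le_iff₀ hn]
      simpa using Finset.sum_le_card_nsmul (Finset.range (n + 1)) (fun k => u k x) _
        fun k _ => hu2 k x
  -- Tychonoff gives a pointwise limit, which suffices: log-regularity is closed under pointwise
  -- limits, and the transfer operator, a finite sum, commutes with them.
  obtain ⟨g, hg, hlim⟩ := (isCompact_univ_pi fun _ : SymbolicSpace r =>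
    isCompact_Icc (a := Real.exp (-(2 * K))) (b := Real.exp (2 * K))).ultrafilter_le_nhds'
      ((hyperfilter ℕ).map F) (Ultrafilter.mem_map.2 (univ_mem' hmem))
  have hT : ∀ x, Tendsto (fun n => F n x) (hyperfilter ℕ) (𝓝 (g x)) :=
    tendsto_pi_nhds.1 hlim
  refine ⟨g, fun x => (Real.exp_pos _).trans_le (hg x trivial).1, fun k x y hxy => ?_, ?_⟩
  · refine le_of_tendsto_of_tendsto' (hT x) ((hT y).const_mul _) fun n => ?_
    rw [hFx, hFx, mul_left_comm, Finset.mul_sum _ _ (Real.exp _)]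
    gcongr with i hi
    exact hreg i k x y hxy
  · ext x
    refine tendsto_nhds_unique (tendsto_transfer_apply hT x) ?_
    -- The sum telescopes, so the average is an eigenfunction up to a boundary term of order `1 /
    -- n`.
    have hrec : ∀ n, transfer q (F n) x =
        lam * (F n x + (u (n + 1) x - u 0 x) / ((n : ℝ) + 1)) := by
      intro n
      simp only [hF, map_smul, map_sum, hus, Pi.smul_apply, Finset.sum_apply, smul_eq_mul]
      rw [← Finset.mul_sum]
      have e : ∑ k ∈ Finset.range (n + 1), u (k + 1) x =
          ∑ k ∈ Finset.range (n + 1), u k x + (u (n + 1) x - u 0 x) := by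
        rw [← Finset.sum_range_sub (fun k => u k x), ← Finset.sum_add_distrib]
        simp
      rw [e]
      ring
    have hz : Tendsto (fun n : ℕ => (u (n + 1) x - u 0 x) / ((n : ℝ) + 1))
        (hyperfilter ℕ) (𝓝 0) := by
      refine Tendsto.mono_left ?_ Nat.hyperfilter_le_atTop
      refine squeeze_zero_norm (a := fun n : ℕ => Real.exp (2 * K) * (1 / ((n : ℝ) + 1))) ?_ ?_
      · intro n
        have hn : (0 : ℝ) < n + 1 := by positivity
        rw [Real.norm_eq_abs, abs_div, abs_of_pos hn, div_eq_mul_one_div]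
        gcongr
        have := Real.exp_pos (-(2 * K))
        rw [abs_le]
        constructor <;> linarith [hu1 (n + 1) x, hu2 (n + 1) x, hu1 0 x, hu2 0 x]
      · simpa using tendsto_one_div_add_atTop_nhds_zero_nat.const_mul (Real.exp (2 * K))
    have := ((hT x).add hz).const_mul lam
    rw [add_zero] at this
    exact this.congr fun n => (hrec n).symm

theorem exists_perron_frobenius (hr : 0 < r) {K : ℝ} (hK0 : 0 ≤ K) (hq : ∀ a x, 0 < q a x)
    (hK : ∀ a, LogRegular (K / 2) (q a)) :
    ∃ lam : ℝ, 0 < lam ∧ ∃ h : SymbolicSpace r → ℝ, (∀ x, 0 < h x) ∧ Continuous h ∧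
      transfer q h = lam • h ∧ ∀ f : SymbolicSpace r → ℝ, Continuous f →
        ∃ m : ℝ, TendstoUniformly (fun (n : ℕ) x => (lam ^ n)⁻¹ * (transfer q ^ n) f x)
          (fun x => m * h x) atTop := by
  obtain ⟨lam, hlam, h, hpos, hreg, heig⟩ := exists_eigenfunction hr hK0 hq hK
  have hcont := hreg.continuous hK0 hpos
  refine ⟨lam, hlam, h, hpos, hcont, heig, fun f hf => ?_⟩
  have x₀ : SymbolicSpace r := fun _ => ⟨0, hr⟩
  have : Nonempty (Fin r) := ⟨⟨0, hr⟩⟩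
  -- Doob transform: the eigenvalue equation says exactly that these weights sum to one.
  set p : Fin r → SymbolicSpace r → ℝ :=
    fun a x => q a x * h (prepend a x) / (lam * h x) with hp
  have hppos : ∀ a x, 0 < p a x := fun a x =>
    div_pos (mul_pos (hq a x) (hpos _)) (mul_pos hlam (hpos x))
  have hpsum : ∀ x, ∑ a, p a x = 1 := by
    intro x
    have h1 := congrFun heig x
    rw [transfer_apply, Pi.smul_apply, smul_eq_mul] at h1
    simp only [hp]
    rw [← Finset.sum_div, h1, div_self (mul_pos hlam (hpos x)).ne']
  -- The constant is `K / 2` from `q`, `K / 2` from `h (prepend a x)` and `K` from the denominator.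
  have hpreg : ∀ a, LogRegular (2 * K) (p a) := by
    intro a n x y hxy
    have h1 := hK a n x y hxy
    have h2 := hreg (n + 1) _ _ (prepend_mem_cylinder a hxy)
    have h3 := hreg n y x ((PiNat.mem_cylinder_comm _ _ _).1 hxy)
    simp only [hp]
    rw [div_le_iff₀ (mul_pos hlam (hpos x))]
    calc q a x * h (prepend a x)
        ≤ (Real.exp (K / 2 * (1 / 2) ^ n) * q a y) *
          (Real.exp (K * (1 / 2) ^ (n + 1)) * h (prepend a y)) :=
          mul_le_mul h1 h2 (hpos _).le (mul_nonneg (Real.exp_pos _).le (hq a y).le)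
      _ = Real.exp (K * (1 / 2) ^ n) * (q a y * h (prepend a y) / (lam * h y)) * (lam * h y) := by
          rw [mul_assoc _ (_ / _), div_mul_cancel₀ _ (mul_pos hlam (hpos y)).ne']
          rw [mul_mul_mul_comm, ← Real.exp_add]
          congr 2; ring
      _ ≤ Real.exp (K * (1 / 2) ^ n) * (q a y * h (prepend a y) / (lam * h y)) *
            (lam * (Real.exp (K * (1 / 2) ^ n) * h x)) := by
          refine mul_le_mul_of_nonneg_left (mul_le_mul_of_nonneg_left h3 hlam.le) ?_
          exact mul_nonneg (Real.exp_pos _).le (hppos a y).le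
      _ = Real.exp (2 * K * (1 / 2) ^ n) * (q a y * h (prepend a y) / (lam * h y)) *
            (lam * h x) := by
          rw [show 2 * K * (1 / 2 : ℝ) ^ n = K * (1 / 2) ^ n + K * (1 / 2) ^ n by ring,
            Real.exp_add]
          ring
  have hple : ∀ a x, |p a x| ≤ 1 := fun a x => by
    rw [abs_of_pos (hppos a x), ← hpsum x]
    exact Finset.single_le_sum (f := fun a => p a x) (fun a _ => (hppos a x).le)
      (Finset.mem_univ a)
  obtain ⟨a₀, ha₀⟩ := Finite.exists_min fun a => p a x₀
  -- The least weight at a single point bounds all weights from below, up to distortion.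
  have hδ : ∀ a x, Real.exp (-(2 * K)) * p a₀ x₀ ≤ p a x := fun a x => by
    rw [Real.exp_neg, inv_mul_le_iff₀ (Real.exp_pos _)]
    exact (ha₀ a).trans ((hpreg a).le_exp_mul x₀ x)
  obtain ⟨m, hm⟩ := exists_tendstoUniformly_transfer_pow hr hppos hpsum
    (mul_pos (Real.exp_pos _) (hppos a₀ x₀)) hδ
    (fun a n x y hxy => (hpreg a).abs_sub_le (by positivity) (hple a) hxy)
    (hf.div hcont fun x => (hpos x).ne')
  refine ⟨m, ?_⟩
  have hiter : ∀ (n : ℕ) x, (lam ^ n)⁻¹ * (transfer q ^ n) f x =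
      (transfer p ^ n) (fun x => f x / h x) x * h x := by
    intro n
    induction n with
    | zero => intro x; simp [(hpos x).ne']
    | succ n ih =>
      intro x
      rw [pow_succ' (transfer q), pow_succ' (transfer p), Module.End.mul_apply,
        Module.End.mul_apply, transfer_apply, transfer_apply, Finset.mul_sum, Finset.sum_mul]
      refine Finset.sum_congr rfl fun a _ => ?_
      have h1 := ih (prepend a x)
      rw [inv_mul_eq_iff_eq_mul₀ (by positivity)] at h1
      rw [h1]
      simp only [hp]
      have := (hpos x).ne'
      field_simp
      ring
  obtain ⟨B, hB⟩ := isCompact_univ.exists_bound_of_continuousOn hcont.continuousOn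
  have hB' : ∀ x, h x ≤ B := fun x => (le_abs_self _).trans (hB x trivial)
  have hB0 : 0 < B := (hpos x₀).trans_le (hB' x₀)
  rw [Metric.tendstoUniformly_iff] at hm ⊢
  intro ε hε
  filter_upwards [hm (ε / B) (by positivity)] with n hn x
  rw [hiter, Real.dist_eq, ← sub_mul, abs_mul, abs_of_pos (hpos x)]
  calc _ ≤ |m - (transfer p ^ n) (fun x => f x / h x) x| * B := by gcongr; exact hB' x
    _ < ε / B * B := by gcongr; exact hn x
    _ = ε := by field_simp

end Perron

/-! ### Measures as functionals, and spectral tools. -/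

theorem exists_probabilityMeasure_integral_eq {r : ℕ} (Λ : C(SymbolicSpace r, ℝ) →ₗ[ℝ] ℝ)
    (hpos : ∀ f : C(SymbolicSpace r, ℝ), (∀ x, 0 ≤ f x) → 0 ≤ Λ f) (h1 : Λ 1 = 1) :
    ∃ ν : ProbabilityMeasure (SymbolicSpace r), ∀ g : C(SymbolicSpace r, ℝ), toDual ν g = Λ g := by
  let Φ : CompactlySupportedContinuousMap (SymbolicSpace r) ℝ →ₚ[ℝ] ℝ :=
    PositiveLinearMap.mk₀
      { toFun := fun f => Λ f.toContinuousMap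
        map_add' := fun f g => Λ.map_add f.toContinuousMap g.toContinuousMap
        map_smul' := fun c f => Λ.map_smul c f.toContinuousMap }
      fun f hf => hpos _ hf
  have hint : ∀ g : C(SymbolicSpace r, ℝ), ∫ x, g x ∂(RealRMK.rieszMeasure Φ) = Λ g := fun g =>
    RealRMK.integral_rieszMeasure Φ ⟨g, HasCompactSupport.of_compactSpace _⟩
  have hprob : IsProbabilityMeasure (RealRMK.rieszMeasure Φ) := by
    have h := hint 1
    rw [h1] at h
    simp only [ContinuousMap.one_apply, integral_const, smul_eq_mul, mul_one] at h
    refine ⟨?_⟩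
    rw [Measure.real, ENNReal.toReal_eq_one_iff] at h
    exact h
  exact ⟨⟨_, hprob⟩, hint⟩

theorem toDual_injective {r : ℕ} :
    Function.Injective (toDual : ProbabilityMeasure (SymbolicSpace r) → _) := by
  intro ν ν' h
  have : IsProbabilityMeasure (ν : Measure (SymbolicSpace r)) := ν.2
  have : IsProbabilityMeasure (ν' : Measure (SymbolicSpace r)) := ν'.2
  refine Subtype.ext (show (ν : Measure (SymbolicSpace r)) = ν' from
    ext_of_forall_integral_eq_of_IsFiniteMeasure fun f => ?_)
  exact congrArg (fun φ => φ f.toContinuousMap) h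

theorem toDual_one {r : ℕ} (ν : ProbabilityMeasure (SymbolicSpace r)) : toDual ν 1 = 1 := by
  simp [toDual_apply]

theorem dualOperator_pow_apply {r : ℕ} (L : C(SymbolicSpace r, ℝ) →L[ℝ] C(SymbolicSpace r, ℝ))
    (n : ℕ) (φ : StrongDual ℝ C(SymbolicSpace r, ℝ)) (g : C(SymbolicSpace r, ℝ)) :
    (dualOperator L ^ n) φ g = φ ((L ^ n) g) := by
  induction n generalizing φ with
  | zero => rfl
  | succ n ih =>
    rw [pow_succ, mul_apply_eq_comp, ih, pow_succ', mul_apply_eq_comp]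
    rfl

/-- If `k` is in the spectrum of `a`, then `k ^ n` is in that of `a ^ n`, so `‖k‖ ^ n` is at most a
constant times `lam ^ n`. Gelfand's formula is avoided, so real scalars are covered too. -/
theorem spectralRadius_le_of_norm_pow_le {𝕜 E : Type*} [RCLike 𝕜] [NormedAddCommGroup E]
    [NormedSpace 𝕜 E] [CompleteSpace E] {a : E →L[𝕜] E} {C lam : ℝ} (hlam : 0 < lam)
    (h : ∀ n, ‖a ^ n‖ ≤ C * lam ^ n) : spectralRadius 𝕜 a ≤ ENNReal.ofReal lam := by
  refine iSup₂_le fun k hk => ?_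
  rw [← enorm_eq_nnnorm, ← ofReal_norm]
  refine ENNReal.ofReal_le_ofReal ?_
  by_contra! hcon
  have h1 : ∀ n : ℕ, (‖k‖ / lam) ^ n ≤ C * ‖(1 : E →L[𝕜] E)‖ := by
    intro n
    rw [div_pow, div_le_iff₀ (by positivity), ← norm_pow]
    calc ‖k ^ n‖ ≤ ‖a ^ n‖ * ‖(1 : E →L[𝕜] E)‖ :=
          spectrum.norm_le_norm_mul_of_mem (spectrum.pow_mem_pow a n hk)
      _ ≤ (C * lam ^ n) * ‖(1 : E →L[𝕜] E)‖ := by gcongr; exact h n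
      _ = _ := by ring
  obtain ⟨n, hn⟩ := pow_unbounded_of_one_lt (C * ‖(1 : E →L[𝕜] E)‖) ((one_lt_div hlam).2 hcon)
  exact (h1 n).not_gt hn

theorem mem_spectrum_of_apply_eq_smul {𝕜 E : Type*} [NontriviallyNormedField 𝕜]
    [NormedAddCommGroup E] [NormedSpace 𝕜 E] {L : E →L[𝕜] E} {k : 𝕜} {v : E} (hv : v ≠ 0)
    (h : L v = k • v) : k ∈ spectrum 𝕜 L := by
  rw [spectrum.mem_iff]
  rintro ⟨u, hu⟩
  refine hv ?_
  have h1 : (u : E →L[𝕜] E) v = 0 := by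
    rw [hu]; simp [Algebra.algebraMap_eq_smul_one, h]
  calc v = ((↑u⁻¹ * ↑u : E →L[𝕜] E)) v := by rw [Units.inv_mul]; rfl
    _ = 0 := by rw [mul_apply_eq_comp, h1, map_zero]

/-! ### The grand-canonical weight and the spectral radius. -/

section Ruelle

variable {r : ℕ} {β μ : ℝ} {A : ℕ → SymbolicSpace r → ℝ}

/-- The grand-canonical weight `W(y) = ∑_N e^{βμN} e^{-β A_N(y)}`. -/
noncomputable def weight (β μ : ℝ) (A : ℕ → SymbolicSpace r → ℝ) (y : SymbolicSpace r) : ℝ :=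
  ∑' N : ℕ, Real.exp (β * μ * N) * Real.exp (-β * A N y)

theorem Admissible.summable_weight (hadm : Admissible β μ A) (a : Fin r) (x : SymbolicSpace r) :
    Summable fun N : ℕ => Real.exp (β * μ * N) * Real.exp (-β * A N (prepend a x)) := by
  refine Summable.of_nonneg_of_le (fun N => by positivity) (fun N => ?_) (hadm x)
  gcongr
  exact Finset.single_le_sum (f := fun a => Real.exp (-β * A N (prepend a x)))
    (fun a _ => (Real.exp_pos _).le) (Finset.mem_univ a)

theorem weight_pos (hadm : Admissible β μ A) (a : Fin r) (x : SymbolicSpace r) :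
    0 < weight β μ A (prepend a x) :=
  (hadm.summable_weight a x).tsum_pos (fun N => by positivity) 0 (by positivity)

/-- The Lipschitz bound is uniform in `N`, so it passes through the series term by term. With `K = β
* M`, the prepended symbol accounts for the factor `1 / 2`. -/
theorem exists_logRegular_weight (hβ : 0 < β) (hlip : UniformlyLipschitz A)
    (hadm : Admissible β μ A) :
    ∃ K, 0 ≤ K ∧ ∀ a : Fin r, LogRegular (K / 2) fun x => weight β μ A (prepend a x) := by
  obtain ⟨M, hM, hA⟩ := hlip
  refine ⟨β * M, by positivity, fun a n x y hxy => ?_⟩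
  simp only [weight]
  rw [← tsum_mul_left]
  refine (hadm.summable_weight a x).tsum_le_tsum (fun N => ?_)
    ((hadm.summable_weight a y).mul_left _)
  rw [mul_left_comm]
  refine mul_le_mul_of_nonneg_left ?_ (Real.exp_pos _).le
  rw [← Real.exp_add, Real.exp_le_exp]
  have h1 := (abs_le.1 (hA N (prepend a y) (prepend a x))).2
  have h2 := shiftDist_le_pow (prepend_mem_cylinder a hxy)
  have h3 : A N (prepend a y) - A N (prepend a x) ≤ M * (1 / 2) ^ (n + 1) :=
    h1.trans (by gcongr)
  have h4 := mul_le_mul_of_nonneg_left h3 hβ.le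
  rw [pow_succ] at h4
  linarith

theorem ruelleSum_eq_sum_weight {𝕜 : Type*} [RCLike 𝕜] (hadm : Admissible β μ A)
    (f : SymbolicSpace r → 𝕜) (x : SymbolicSpace r) :
    ruelleSum β μ A f x = ∑ a, (weight β μ A (prepend a x) : 𝕜) * f (prepend a x) := by
  refine HasSum.tsum_eq ?_
  have h1 : ∀ a : Fin r, HasSum (fun N : ℕ =>
      ((Real.exp (β * μ * N) * Real.exp (-β * A N (prepend a x)) : ℝ) : 𝕜) * f (prepend a x))
      ((weight β μ A (prepend a x) : 𝕜) * f (prepend a x)) := fun a =>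
    ((RCLike.hasSum_ofReal 𝕜).2 (hadm.summable_weight a x).hasSum).mul_right _
  convert hasSum_sum fun a (_ : a ∈ Finset.univ) => h1 a using 2 with N
  rw [Finset.mul_sum]
  exact Finset.sum_congr rfl fun a _ => by push_cast; ring

theorem coe_grandCanonicalRuelle_pow (hlip : UniformlyLipschitz A) (hadm : Admissible β μ A)
    (n : ℕ) (f : C(SymbolicSpace r, ℝ)) :
    ⇑((grandCanonicalRuelle ℝ β μ A hlip hadm ^ n) f) =
      (transfer (fun a x => weight β μ A (prepend a x)) ^ n) f := by
  induction n with
  | zero => rfl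
  | succ n ih =>
    rw [pow_succ', pow_succ', mul_apply_eq_comp, Module.End.mul_apply, ← ih]
    ext x
    rw [grandCanonicalRuelle_apply, ruelleSum_eq_sum_weight hadm, transfer_apply]
    rfl

theorem norm_grandCanonicalRuelle_pow_apply_le {𝕜 : Type*} [RCLike 𝕜]
    (hlip : UniformlyLipschitz A) (hadm : Admissible β μ A) {lam c : ℝ} {h : SymbolicSpace r → ℝ}
    (heig : ∀ x, ∑ a, weight β μ A (prepend a x) * h (prepend a x) = lam * h x)
    {f : C(SymbolicSpace r, 𝕜)} (hf : ∀ x, ‖f x‖ ≤ c * h x) (n : ℕ) :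
    ∀ x, ‖(grandCanonicalRuelle 𝕜 β μ A hlip hadm ^ n) f x‖ ≤ c * lam ^ n * h x := by
  induction n with
  | zero => simpa using hf
  | succ n ih =>
    intro x
    rw [pow_succ', mul_apply_eq_comp, grandCanonicalRuelle_apply, ruelleSum_eq_sum_weight hadm]
    calc _ ≤ ∑ a, weight β μ A (prepend a x) * (c * lam ^ n * h (prepend a x)) := by
          refine (norm_sum_le _ _).trans (Finset.sum_le_sum fun a _ => ?_)
          rw [norm_mul, RCLike.norm_ofReal, abs_of_pos (weight_pos hadm a x)]
          exact mul_le_mul_of_nonneg_left (ih _) (weight_pos hadm a x).le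
      _ = c * lam ^ n * ∑ a, weight β μ A (prepend a x) * h (prepend a x) := by
          rw [Finset.mul_sum]
          exact Finset.sum_congr rfl fun a _ => by ring
      _ = _ := by rw [heig]; ring

/-- Since `h` lies between positive constants `m` and `B`, domination by multiples of `h` gives
`‖Lⁿ‖ ≤ B / m * lam ^ n`. Conversely `lam` is an eigenvalue. -/
theorem spectralRadius_grandCanonicalRuelle (𝕜 : Type*) [RCLike 𝕜] (hr : 0 < r)
    (hlip : UniformlyLipschitz A) (hadm : Admissible β μ A) {lam : ℝ} (hlam : 0 < lam)
    {h : C(SymbolicSpace r, ℝ)} (hpos : ∀ x, 0 < h x)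
    (heig : ∀ x, ∑ a, weight β μ A (prepend a x) * h (prepend a x) = lam * h x) :
    spectralRadius 𝕜 (grandCanonicalRuelle 𝕜 β μ A hlip hadm) = ENNReal.ofReal lam := by
  have x₀ : SymbolicSpace r := fun _ => ⟨0, hr⟩
  refine le_antisymm ?_ ?_
  · obtain ⟨z, -, hz⟩ := isCompact_univ.exists_isMinOn ⟨x₀, trivial⟩ h.continuous.continuousOn
    have hz' : ∀ x, h z ≤ h x := fun x => hz (Set.mem_univ x)
    obtain ⟨B, hB⟩ : ∃ B : ℝ, ∀ x, h x ≤ B :=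
      ⟨‖h‖, fun x => (le_abs_self _).trans (h.norm_coe_le_norm x)⟩
    have hB0 : 0 ≤ B := (hpos z).le.trans (hB z)
    have hm := hpos z
    generalize h z = m at hz' hm
    have key : ∀ n, ‖grandCanonicalRuelle 𝕜 β μ A hlip hadm ^ n‖ ≤ B / m * lam ^ n := by
      intro n
      have hC : 0 ≤ B / m * lam ^ n := by positivity
      refine ContinuousLinearMap.opNorm_le_bound _ hC fun f => ?_
      refine (ContinuousMap.norm_le _ (mul_nonneg hC (norm_nonneg _))).2 fun x => ?_
      refine (norm_grandCanonicalRuelle_pow_apply_le hlip hadm heig (c := ‖f‖ / m)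
        (fun y => ?_) n x).trans ?_
      · rw [div_mul_eq_mul_div, le_div_iff₀ hm]
        exact mul_le_mul (f.norm_coe_le_norm y) (hz' y) hm.le (norm_nonneg _)
      · calc _ ≤ ‖f‖ / m * lam ^ n * B := by gcongr; exact hB x
          _ = _ := by ring
    exact spectralRadius_le_of_norm_pow_le hlam key
  · let h' : C(SymbolicSpace r, 𝕜) := ⟨fun x => (h x : 𝕜), by fun_prop⟩
    have hne : h' ≠ 0 := fun h0 => by
      have := congrArg (fun g : C(SymbolicSpace r, 𝕜) => g x₀) h0
      exact (hpos x₀).ne' (RCLike.ofReal_eq_zero.1 this)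
    have hmem : (lam : 𝕜) ∈ spectrum 𝕜 (grandCanonicalRuelle 𝕜 β μ A hlip hadm) := by
      refine mem_spectrum_of_apply_eq_smul hne ?_
      ext x
      rw [grandCanonicalRuelle_apply, ruelleSum_eq_sum_weight hadm]
      change ∑ a, (weight β μ A (prepend a x) : 𝕜) * (h (prepend a x) : 𝕜) =
        (lam : 𝕜) * (h x : 𝕜)
      rw [← RCLike.ofReal_mul, ← heig x]
      push_cast
      rfl
    refine le_trans (le_of_eq ?_) (le_iSup₂ (f := fun (k : 𝕜) (_ : k ∈ spectrum 𝕜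
      (grandCanonicalRuelle 𝕜 β μ A hlip hadm)) => (‖k‖₊ : ENNReal)) _ hmem)
    rw [← enorm_eq_nnnorm, ← ofReal_norm, RCLike.norm_ofReal, abs_of_pos hlam]

end Ruelle

/-- If the normalized iterates of a positive operator on `C(Ω)` converge uniformly to multiples of
a positive eigenfunction, then the limit coefficients are given by integration against an
eigenmeasure. -/
theorem exists_eigenmeasure {r : ℕ} (hr : 0 < r)
    {L : C(SymbolicSpace r, ℝ) →L[ℝ] C(SymbolicSpace r, ℝ)}
    (hL : ∀ n (f : C(SymbolicSpace r, ℝ)), (∀ x, 0 ≤ f x) → ∀ x, 0 ≤ (L ^ n) f x)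
    {lam : ℝ} (hlam : 0 < lam) {h : C(SymbolicSpace r, ℝ)} (hpos : ∀ x, 0 < h x)
    (heig : L h = lam • h)
    (hconv : ∀ g : C(SymbolicSpace r, ℝ), ∃ m : ℝ, TendstoUniformly
      (fun (n : ℕ) x => (lam ^ n)⁻¹ * (L ^ n) g x) (fun x => m * h x) atTop) :
    ∃ (h₁ : C(SymbolicSpace r, ℝ)) (ν : ProbabilityMeasure (SymbolicSpace r)),
      (∀ x, 0 < h₁ x) ∧ L h₁ = lam • h₁ ∧ dualOperator L (toDual ν) = lam • toDual ν ∧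
      toDual ν h₁ = 1 ∧ ∀ g : C(SymbolicSpace r, ℝ), TendstoUniformly
        (fun (n : ℕ) x => (lam ^ n)⁻¹ * (L ^ n) g x) (fun x => toDual ν g * h₁ x) atTop := by
  have x₀ : SymbolicSpace r := fun _ => ⟨0, hr⟩
  -- Evaluation at `x₀` and uniqueness of limits make `F` linear and positive, with `F (L g) = lam *
  -- F g`.
  choose F hF using hconv
  have hFx : ∀ g, Tendsto (fun n : ℕ => (lam ^ n)⁻¹ * (L ^ n) g x₀) atTop (𝓝 (F g * h x₀)) :=
    fun g => (hF g).tendsto_at x₀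
  have hcancel : ∀ {a b : ℝ}, a * h x₀ = b * h x₀ → a = b := fun e =>
    mul_right_cancel₀ (hpos x₀).ne' e
  have hadd : ∀ f g, F (f + g) = F f + F g := fun f g => hcancel <| by
    refine tendsto_nhds_unique (hFx (f + g)) ?_
    rw [add_mul]
    refine ((hFx f).add (hFx g)).congr fun n => ?_
    rw [map_add, ContinuousMap.add_apply]; ring
  have hsmul : ∀ (c : ℝ) f, F (c • f) = c * F f := fun c f => hcancel <| by
    refine tendsto_nhds_unique (hFx (c • f)) ?_
    rw [mul_assoc]
    refine ((hFx f).const_mul c).congr fun n => ?_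
    rw [map_smul, ContinuousMap.smul_apply, smul_eq_mul]; ring
  have hnn : ∀ f : C(SymbolicSpace r, ℝ), (∀ x, 0 ≤ f x) → 0 ≤ F f := fun f hf => by
    have h1 : 0 ≤ F f * h x₀ := ge_of_tendsto' (hFx f) fun n =>
      mul_nonneg (by positivity) (hL n f hf x₀)
    exact nonneg_of_mul_nonneg_left h1 (hpos x₀)
  have hFL : ∀ g, F (L g) = lam * F g := fun g => hcancel <| by
    refine tendsto_nhds_unique (hFx (L g)) ?_
    rw [mul_assoc]
    refine (((hFx g).comp (tendsto_add_atTop_nat 1)).const_mul lam).congr fun n => ?_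
    rw [Function.comp_apply, pow_succ L, mul_apply_eq_comp, pow_succ]
    field_simp
  have hiter : ∀ n, (L ^ n) h = lam ^ n • h := fun n => by
    induction n with
    | zero => simp
    | succ n ih => rw [pow_succ, mul_apply_eq_comp, heig, map_smul, ih, smul_smul, pow_succ']
  have hFh : F h = 1 := hcancel <| by
    refine tendsto_nhds_unique (hFx h) (tendsto_const_nhds.congr fun n => ?_)
    rw [hiter, ContinuousMap.smul_apply, smul_eq_mul]
    field_simp
  -- Positivity on `‖h‖ - h` gives `‖h‖ * F 1 ≥ F h = 1`.
  have hF1 : 0 < F 1 := by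
    have h1 := hnn (‖h‖ • 1 - h) fun x => by
      simpa using (le_abs_self _).trans (h.norm_coe_le_norm x)
    have h2 := hadd (‖h‖ • 1 - h) h
    rw [sub_add_cancel, hsmul, hFh] at h2
    have h3 : 0 < ‖h‖ * F 1 := by linarith
    exact pos_of_mul_pos_right h3 (norm_nonneg _)
  obtain ⟨ν, hν⟩ := exists_probabilityMeasure_integral_eq
    { toFun := fun g => (F 1)⁻¹ * F g
      map_add' := fun f g => by rw [hadd, mul_add]
      map_smul' := fun c f => by
        rw [hsmul, RingHom.id_apply, smul_eq_mul, mul_left_comm] }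
    (fun f hf => mul_nonneg (inv_nonneg.2 hF1.le) (hnn f hf)) (inv_mul_cancel₀ hF1.ne')
  replace hν : ∀ g, toDual ν g = (F 1)⁻¹ * F g := hν
  -- Dividing `F` by `F 1` makes `ν` a probability; multiplying `h` by `F 1` compensates.
  refine ⟨F 1 • h, ν, fun x => mul_pos hF1 (hpos x), ?_, ?_, ?_, fun g => ?_⟩
  · rw [map_smul, heig, smul_comm]
  · ext g
    change toDual ν (L g) = lam * toDual ν g
    rw [hν, hν, hFL, mul_left_comm]
  · rw [hν, hsmul, hFh, mul_one, inv_mul_cancel₀ hF1.ne']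
  · have h1 : (fun x => toDual ν g * (F 1 • h) x) = fun x => F g * h x := by
      ext x
      rw [hν, ContinuousMap.smul_apply, smul_eq_mul]
      field_simp
    rw [h1]
    exact hF g

theorem toDual_tendsto_of_tendstoUniformly {r : ℕ} (θ : ProbabilityMeasure (SymbolicSpace r))
    {F : ℕ → C(SymbolicSpace r, ℝ)} {f : C(SymbolicSpace r, ℝ)}
    (h : TendstoUniformly (fun n x => F n x) f atTop) :
    Tendsto (fun n => toDual θ (F n)) atTop (𝓝 (toDual θ f)) :=
  ((toDual θ).continuous.tendsto f).comp (ContinuousMap.tendsto_iff_tendstoUniformly.2 h)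

end GrandCanonical

/-! ### The Ruelle–Perron–Frobenius theorem. -/

theorem mainTheorem1 {r : ℕ} (hr : 2 ≤ r) (β μ : ℝ) (hβ : 0 < β) (hμ : μ < 0)
    (A : ℕ → SymbolicSpace r → ℝ)
    (hlip : UniformlyLipschitz A) (hsup : Superlinear μ A) (hadm : Admissible β μ A) :
    ∃ lam : ℝ, 0 < lam ∧
      -- `lam` is the spectral radius of the operator, on `C(Ω; ℂ)` as well as on `C(Ω; ℝ)`
      spectralRadius ℂ (grandCanonicalRuelle ℂ β μ A hlip hadm) = ENNReal.ofReal lam ∧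
      spectralRadius ℝ (grandCanonicalRuelle ℝ β μ A hlip hadm) = ENNReal.ofReal lam ∧
      ∃ (h : C(SymbolicSpace r, ℝ)) (ν : ProbabilityMeasure (SymbolicSpace r)),
        (∀ x, 0 < h x) ∧
        grandCanonicalRuelle ℝ β μ A hlip hadm h = lam • h ∧
        dualOperator (grandCanonicalRuelle ℝ β μ A hlip hadm) (toDual ν) = lam • toDual ν ∧
        toDual ν h = 1 ∧
        -- uniqueness of `h` and of `ν`
        (∀ h' : C(SymbolicSpace r, ℝ), (∀ x, 0 < h' x) →
          grandCanonicalRuelle ℝ β μ A hlip hadm h' = lam • h' → toDual ν h' = 1 → h' = h) ∧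
        (∀ ν' : ProbabilityMeasure (SymbolicSpace r),
          dualOperator (grandCanonicalRuelle ℝ β μ A hlip hadm) (toDual ν') = lam • toDual ν' →
          ν' = ν) ∧
        (∀ g : C(SymbolicSpace r, ℝ),
          TendstoUniformly
            (fun (n : ℕ) x => (lam ^ n)⁻¹ * (grandCanonicalRuelle ℝ β μ A hlip hadm ^ n) g x)
            (fun x => toDual ν g * h x) atTop) ∧
        -- weak convergence of measures is weak-* convergence in `C(Ω)*`
        (∀ θ : ProbabilityMeasure (SymbolicSpace r),
          Tendsto
            (fun n : ℕ => StrongDual.toWeakDual ((lam ^ n)⁻¹ •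
              (dualOperator (grandCanonicalRuelle ℝ β μ A hlip hadm) ^ n) (toDual θ)))
            atTop
            (𝓝 (StrongDual.toWeakDual (toDual θ h • toDual ν)))) := by
  have hr0 : 0 < r := by omega
  obtain ⟨K, hK0, hK⟩ := exists_logRegular_weight hβ hlip hadm
  obtain ⟨lam, hlam, h₀, hpos₀, hcont₀, heig₀, hconv₀⟩ :=
    exists_perron_frobenius hr0 hK0 (fun a x => weight_pos hadm a x) hK
  have hpow := coe_grandCanonicalRuelle_pow hlip hadm
  have hspec := fun (𝕜 : Type) [RCLike 𝕜] => spectralRadius_grandCanonicalRuelle 𝕜 hr0 hlip hadm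
    hlam (h := ⟨h₀, hcont₀⟩) hpos₀ (congrFun heig₀)
  refine ⟨lam, hlam, hspec ℂ, hspec ℝ, ?_⟩
  set L := grandCanonicalRuelle ℝ β μ A hlip hadm with hLdef
  obtain ⟨h, ν, hpos, heig, hdual, hνh, hconv⟩ := exists_eigenmeasure hr0 (L := L)
    (fun n f hf x => by
      have := transfer_pow_mono (fun a x => weight_pos hadm a x) n (f := 0) (g := f) hf x
      rw [map_zero] at this
      rwa [hpow])
    hlam (h := ⟨h₀, hcont₀⟩) hpos₀
    (by
      have := hpow 1 ⟨h₀, hcont₀⟩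
      rw [pow_one, pow_one] at this
      exact DFunLike.coe_injective (this.trans heig₀))
    (fun g => by
      obtain ⟨m, hm⟩ := hconv₀ g g.continuous
      refine ⟨m, ?_⟩
      simp only [hpow]
      exact hm)
  have hθ : ∀ (θ : ProbabilityMeasure (SymbolicSpace r)) (g : C(SymbolicSpace r, ℝ)),
      Tendsto (fun n : ℕ => (lam ^ n)⁻¹ * toDual θ ((L ^ n) g)) atTop
        (𝓝 (toDual θ h * toDual ν g)) := by
    intro θ g
    have := toDual_tendsto_of_tendstoUniformly θ (F := fun n => (lam ^ n)⁻¹ • (L ^ n) g)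
      (f := toDual ν g • h) (hconv g)
    simpa only [map_smul, smul_eq_mul, mul_comm (toDual ν g)] using this
  refine ⟨h, ν, hpos, heig, hdual, hνh, fun h' _ heig' hν' => ?_, fun ν' hν' => ?_, hconv,
    fun θ => ?_⟩
  -- For an eigenfunction the normalized iterates are constant, so `h'` equals its own limit `ν(h')
  -- h = h`.
  · have hiter : ∀ n, (L ^ n) h' = lam ^ n • h' := fun n => by
      induction n with
      | zero => simp
      | succ n ih => rw [pow_succ, mul_apply_eq_comp, heig', map_smul, ih, smul_smul, pow_succ']
    ext x
    have h1 := (hconv h').tendsto_at x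
    rw [hν', one_mul] at h1
    refine tendsto_nhds_unique (tendsto_const_nhds.congr fun n => ?_) h1
    rw [hiter, ContinuousMap.smul_apply, smul_eq_mul]
    field_simp
  · have hiter : ∀ n g, toDual ν' ((L ^ n) g) = lam ^ n * toDual ν' g := fun n => by
      induction n with
      | zero => simp
      | succ n ih =>
        intro g
        have h1 : toDual ν' (L g) = lam * toDual ν' g := congrArg (fun φ => φ g) hν'
        rw [pow_succ, mul_apply_eq_comp, ih, h1, pow_succ, mul_assoc]
    -- Invariance makes the sequence in `hθ` constant, so `ν'` is a multiple of `ν`; testing on `1`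
    -- shows that the factor is one.
    have h2 : ∀ g, toDual ν' g = toDual ν' h * toDual ν g := fun g => by
      refine tendsto_nhds_unique (tendsto_const_nhds.congr fun n => ?_) (hθ ν' g)
      rw [hiter]
      field_simp
    have h3 := h2 1
    rw [toDual_one, toDual_one, mul_one] at h3
    refine toDual_injective (ContinuousLinearMap.ext fun g => ?_)
    rw [h2, ← h3, one_mul]
  · rw [tendsto_iff_forall_eval_tendsto_topDualPairing]
    intro g
    refine (hθ θ g).congr fun n => ?_
    rw [← dualOperator_pow_apply]
    rfl
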